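/- Call a group $G$ capable if $G\cong K/Z(K)$ for some group $K$. A subset of a group is a minimal generating set if it generates the group and no proper subset of it does. For a group $F$ let $F_1=F$ and $F_{n+1}=[F_n,F]$. Let $p$ be a prime and $c$ a positive integer. Let $F=C_p*\mathbf{Z}$ be the free product of a cyclic group of order $p$ generated by $a$ and an infinite cyclic group generated by $z$, let $\mathcal{G}=C_p\amalg^{\mathfrak{N}_{c+1}}\mathbf{Z}=F/F_{c+2}$ be the $(c+1)$-nilpotent product of $C_p$ and $\mathbf{Z}$, and let $G=\mathcal{G}/Z(\mathcal{G})$. Then: 1. $G$ is a finite $p$-group, it is capable and nilpotent of class exactly $c$, the images $\bar a,\bar z$ of $a,z$ in $G$ are distinct, $\{\bar a,\bar z\}$ is a minimal generating set of $G$, $\bar a$ has order $p$, and $\bar z$ has order $p^{1+\lfloor (c-1)/(p-1)\rfloor}$. 2. Consequently the following bound is best possible. The least integer $m\ge 0$ for which the inequality $\beta\le\alpha+m$ holds whenever a capable $p$-group of nilpotency class exactly $c$ has a minimal generating set $\{x_1,\dots,x_n\}$ of $n\ge 2$ distinct elements with $o(x_1)\le\cdots\le o(x_n)$, $o(x_{n-1})=p^{\alpha}$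 and $o(x_n)=p^{\beta}$, is $m=\lfloor (c-1)/(p-1)\rfloor$. In particular the inequality does hold with this $m$. -/

import Mathlib

universe u

/-- A group is capable if it is isomorphic to `K / Z(K)` for some group `K`. -/
def Capable (G : Type u) [Group G] : Prop :=
  ∃ (K : Type u) (_ : Group K), Nonempty (G ≃* K ⧸ Subgroup.center K)

/-- `G` is nilpotent of class exactly `c`. -/
def HasNilpotencyClass (G : Type u) [Group G] (c : ℕ) : Prop :=
  ∃ _ : Group.IsNilpotent G, Group.nilpotencyClass G = c

/-- `S` generates `G`, and no proper subset of `S` does. -/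
def IsMinimalGeneratingSet {G : Type u} [Group G] (S : Set G) : Prop :=
  Minimal (fun T : Set G => Subgroup.closure T = ⊤) S

/-- The `k`-nilpotent product `F / F_{k+1}` of two groups, where `F` is their free product and
`F_1 = F`, `F_{n+1} = [F_n, F]`. Mathlib's series starts at index `0`, so `F_{k+1}` is its term
with index `k`. -/
abbrev NilpotentProduct (k : ℕ) (A B : Type u) [Group A] [Group B] : Type u :=
  Monoid.Coprod A B ⧸ (⊤ : Subgroup (Monoid.Coprod A B)).lowerCentralSeries k

/-- The `k`-nilpotent product of the cyclic group of order `p` and the infinite cyclic group. -/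
abbrev CyclicNilpotentProduct (k p : ℕ) : Type :=
  NilpotentProduct k (Multiplicative (ZMod p)) (Multiplicative ℤ)

/-- The quotient of the `k`-nilpotent product of `C_p` and `ℤ` by its center. -/
abbrev CentralQuotient (k p : ℕ) : Type :=
  CyclicNilpotentProduct k p ⧸ Subgroup.center (CyclicNilpotentProduct k p)

/-- The image of the generator of `C_p`. -/
def genA (k p : ℕ) : CentralQuotient k p :=
  QuotientGroup.mk (QuotientGroup.mk (Monoid.Coprod.inl (Multiplicative.ofAdd (1 : ZMod p))))

/-- The image of the generator of the infinite cyclic group. -/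
def genZ (k p : ℕ) : CentralQuotient k p :=
  QuotientGroup.mk (QuotientGroup.mk (Monoid.Coprod.inr (Multiplicative.ofAdd (1 : ℤ))))

/-- The inequality `b ≤ a + m` holds for all capable `p`-groups of class exactly `c` that are
minimally generated by at least two (distinct) elements, listed with nondecreasing orders, the last
two of which are `p ^ a` and `p ^ b`. -/
def CapableOrderBound (p c m : ℕ) : Prop :=
  ∀ (G : Type u) [Group G], IsPGroup p G → Capable G → HasNilpotencyClass G c →
    ∀ (n : ℕ) (x : Fin (n + 2) → G), Function.Injective x →
      IsMinimalGeneratingSet (Set.range x) → Monotone (fun i => orderOf (x i)) →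
      ∀ a b : ℕ, orderOf (x (Fin.last n).castSucc) = p ^ a →
        orderOf (x (Fin.last (n + 1))) = p ^ b → b ≤ a + m

/-!
Write `Γ_j` for the lower central series, numbered from `1`.

**Upper bound.** Let `G = K / Z(K)` be capable of class `c`, so that `K` has class at most `c + 1`.
If `x, y ∈ K` and `x ^ (p ^ α)` is central, it has to be shown that `y ^ (p ^ (α + m))` commutes
with `x`, where `m = ⌊(c - 1) / (p - 1)⌋` (`commute_pow_of_commute_pow`). The tool is the theory of
polynomial sequences `ℕ → G` in a group with filtration `Γ` (`IsPolynomialSeq`): by Lazard's theorem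
(`IsPolynomialSeq.mul_and_commutator`) they are closed under products, commutators add levels, and a
sequence `f` of level `j` has a Taylor expansion `f(n) = ∏ g_i ^ (n.choose i)` with
`g_i ∈ Γ_{i + j}`, which is used in the form `IsPolynomialSeq.apply_eq_one`.

In the group generated by `x` and `y`, every `u ∈ Γ_j` with `j ≥ 2` is the value at `1` of a
polynomial sequence of level `j - 1` that is trivial at all multiples of `p ^ α`; for `⁅x, y⁆` this
is `n ↦ ⁅x ^ n, y⁆`. Evaluating the Taylor expansion at `N = p ^ (α + ⌊(c + 1 - j) / (p - 1)⌋)` and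
using downward induction on `j`, all factors but `u ^ N` vanish, because the denominators of
`N.choose i` are controlled by `v_p(i) (p - 1) < i`. Hence `u ^ N = 1`
(`pow_eq_one_of_mem_lcsFiltration`). The expansion of `n ↦ ⁅x, y ^ n⁆` then gives the claim.

**Sharpness.** The group generated by `a : x ↦ ζ x` and `z : x ↦ x + 1` acting on `ℤ[ζ]`, with `ζ` a
primitive `p`-th root of unity, has the `j`-th term of its lower central series inside the
translations by `(1 - ζ) ^ (j - 1) ℤ[ζ]` for `j ≥ 2`. The commutator of `z ^ (p ^ m)` and `a` is the
translation by `p ^ m (1 - ζ)`, and a comparison of norms shows that it is not in `Γ_{c + 2}` when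
`m (p - 1) < c` (`exists_commutators_notMem_lowerCentralSeries`). Therefore `z ^ (p ^ m)` is not
central in the nilpotent product, while `z ^ (p ^ (1 + m))` is, by the upper bound. That the
central quotient is a finite `p`-group holds for every nilpotent group generated by finitely many
elements of `p`-power order, by Schur's theorem.
-/

open scoped commutatorElement

/-! ### Polynomial sequences in a filtered group -/

section PolynomialSequences

variable {G : Type*} [Group G]

/-- The difference `n ↦ f(n)⁻¹ f(n + 1)` of a sequence in a group. -/
def seqDiff (f : ℕ → G) : ℕ → G := fun n => (f n)⁻¹ * f (n + 1)

/-- Polynomial sequences of level `i` with respect to a filtration `Γ`: the value at `0` lies in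
`Γ i`, and the differences of `f` and of `f⁻¹` are polynomial of level `i + 1`; the recursion ends
at the constant sequence `1`. Including `f⁻¹` makes closure under inverses automatic. -/
inductive IsPolynomialSeq (Γ : ℕ → Subgroup G) : ℕ → (ℕ → G) → Prop
  | one (i : ℕ) : IsPolynomialSeq Γ i 1
  | step (i : ℕ) (f : ℕ → G) : f 0 ∈ Γ i → IsPolynomialSeq Γ (i + 1) (seqDiff f) →
      IsPolynomialSeq Γ (i + 1) (seqDiff f⁻¹) → IsPolynomialSeq Γ i f

@[simp] theorem seqDiff_one : seqDiff (1 : ℕ → G) = 1 := by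
  ext n; simp [seqDiff]

@[simp] theorem seqDiff_const (y : G) : seqDiff (fun _ => y) = 1 := by
  ext n; simp [seqDiff]

theorem eq_one_of_seqDiff_eq_one {f : ℕ → G} (h0 : f 0 = 1) (h : seqDiff f = 1) : f = 1 := by
  ext n
  induction n with
  | zero => simpa using h0
  | succ n ih =>
    have := congrFun h n
    simp only [seqDiff, Pi.one_apply] at this ih ⊢
    rwa [ih, inv_one, one_mul] at this

theorem seqDiff_mul (f g : ℕ → G) : seqDiff (f * g) = g⁻¹ * seqDiff f * g * seqDiff g := by
  ext n
  simp only [seqDiff, Pi.mul_apply, Pi.inv_apply]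
  group

/-- The difference of a commutator is built from commutators of deeper level. -/
theorem seqDiff_commutator (f g : ℕ → G) :
    seqDiff ⁅f, g⁆ = ⁅f, g⁆⁻¹ * (f * (⁅seqDiff f, g⁆ * (g * ⁅seqDiff f, seqDiff g⁆ * g⁻¹)) * f⁻¹) *
      ⁅f, g⁆ * (g * ⁅f, seqDiff g⁆ * g⁻¹) := by
  ext n
  simp only [seqDiff, commutatorElement_def, Pi.mul_apply, Pi.inv_apply]
  group

namespace IsPolynomialSeq

variable {Γ : ℕ → Subgroup G} {i j : ℕ} {f g : ℕ → G}

theorem zero_mem (h : IsPolynomialSeq Γ i f) : f 0 ∈ Γ i := by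
  cases h with
  | one => exact one_mem _
  | step _ _ h0 _ _ => exact h0

theorem diff (h : IsPolynomialSeq Γ i f) : IsPolynomialSeq Γ (i + 1) (seqDiff f) := by
  cases h with
  | one => rw [seqDiff_one]; exact one _
  | step _ _ _ h1 _ => exact h1

theorem diff_inv (h : IsPolynomialSeq Γ i f) : IsPolynomialSeq Γ (i + 1) (seqDiff f⁻¹) := by
  cases h with
  | one => rw [inv_one, seqDiff_one]; exact one _
  | step _ _ _ _ h2 => exact h2

theorem inv (h : IsPolynomialSeq Γ i f) : IsPolynomialSeq Γ i f⁻¹ :=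
  step _ _ (inv_mem h.zero_mem) h.diff_inv (by rw [inv_inv]; exact h.diff)

theorem of_succ (hΓ : Antitone Γ) (h : IsPolynomialSeq Γ i f) :
    ∀ {k : ℕ}, i = k + 1 → IsPolynomialSeq Γ k f := by
  induction h with
  | one i => intro k _; exact one _
  | step i f h0 _ _ ih1 ih2 =>
    rintro k rfl
    exact step _ _ (hΓ (Nat.le_succ k) h0) (ih1 rfl) (ih2 rfl)

theorem mono (hΓ : Antitone Γ) (h : IsPolynomialSeq Γ i f) (hji : j ≤ i) :
    IsPolynomialSeq Γ j f := by
  induction i, hji using Nat.le_induction with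
  | base => exact h
  | succ k _ ih => exact ih (h.of_succ hΓ rfl)

theorem const {y : G} (hy : y ∈ Γ i) : IsPolynomialSeq Γ i (fun _ => y) :=
  step _ _ hy (by rw [seqDiff_const]; exact one _)
    (by
      have : (fun _ => y : ℕ → G)⁻¹ = fun _ => y⁻¹ := rfl
      rw [this, seqDiff_const]; exact one _)

theorem eq_one {s : ℕ} (hs : ∀ i, s < i → Γ i = ⊥) (h : IsPolynomialSeq Γ i f) (hi : s < i) :
    f = 1 := by
  induction h with
  | one => rfl
  | step i f h0 _ _ ih1 _ =>
    rw [hs i hi, Subgroup.mem_bot] at h0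
    exact eq_one_of_seqDiff_eq_one h0 (ih1 (by omega))

/-- Lazard's theorem: polynomial sequences of a fixed level are closed under products, and the
commutator of sequences of levels `i` and `j` has level `i + j`. The two statements are proved
together by downward induction on the level; above level `2 * s` one of the two factors of the
commutator is trivial. -/
theorem mul_and_commutator {s : ℕ} (hΓ : Antitone Γ) (hs : ∀ i, s < i → Γ i = ⊥)
    (hc : ∀ i j, ⁅Γ i, Γ j⁆ ≤ Γ (i + j)) (d k : ℕ) (hd : 2 * s < k + d) :
    (∀ f g, IsPolynomialSeq Γ k f → IsPolynomialSeq Γ k g → IsPolynomialSeq Γ k (f * g)) ∧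
    (∀ i j, i + j = k → ∀ f g, IsPolynomialSeq Γ i f → IsPolynomialSeq Γ j g →
      IsPolynomialSeq Γ k ⁅f, g⁆) := by
  induction d generalizing k with
  | zero =>
    constructor
    · intro f g hf hg
      rw [hf.eq_one hs (by omega), one_mul]; exact hg
    · rintro i j rfl f g hf hg
      rcases Nat.lt_or_ge s i with h | h
      · rw [hf.eq_one hs h, commutatorElement_one_left]; exact one _
      · rw [hg.eq_one hs (by omega), commutatorElement_one_right]; exact one _
  | succ d ih =>
    have mulA : ∀ f g, IsPolynomialSeq Γ (k + 1) f → IsPolynomialSeq Γ (k + 1) g →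
        IsPolynomialSeq Γ (k + 1) (f * g) := (ih (k + 1) (by omega)).1
    have comB : ∀ i j, k + 1 ≤ i + j → ∀ f g, IsPolynomialSeq Γ i f → IsPolynomialSeq Γ j g →
        IsPolynomialSeq Γ (k + 1) ⁅f, g⁆ := fun i j hij f g hf hg =>
      ((ih (i + j) (by omega)).2 i j rfl f g hf hg).mono hΓ hij
    have conj : ∀ i f u, IsPolynomialSeq Γ i f → IsPolynomialSeq Γ (k + 1) u →
        IsPolynomialSeq Γ (k + 1) (f * u * f⁻¹) := fun i f u hf hu => by
      have : f * u * f⁻¹ = ⁅f, u⁆ * u := by simp [commutatorElement_def]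
      rw [this]
      exact mulA _ _ (comB i (k + 1) (by omega) _ _ hf hu) hu
    have conj' : ∀ i f u, IsPolynomialSeq Γ i f → IsPolynomialSeq Γ (k + 1) u →
        IsPolynomialSeq Γ (k + 1) (f⁻¹ * u * f) := fun i f u hf hu => by
      simpa using conj i f⁻¹ u hf.inv hu
    have diffMul : ∀ f g, IsPolynomialSeq Γ k f → IsPolynomialSeq Γ k g →
        IsPolynomialSeq Γ (k + 1) (seqDiff (f * g)) := fun f g hf hg => by
      rw [seqDiff_mul]
      exact mulA _ _ (conj' k _ _ hg hf.diff) hg.diff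
    -- Conjugation by `⁅f, g⁆`, whose level is not yet known, is conjugation by `f` and `g`.
    have diffCom : ∀ i j, i + j = k → ∀ f g, IsPolynomialSeq Γ i f → IsPolynomialSeq Γ j g →
        IsPolynomialSeq Γ (k + 1) (seqDiff ⁅f, g⁆) := fun i j hij f g hf hg => by
      rw [seqDiff_commutator]
      have hA := conj i f _ hf (mulA _ _ (comB (i + 1) j (by omega) _ _ hf.diff hg)
        (conj j g _ hg (comB (i + 1) (j + 1) (by omega) _ _ hf.diff hg.diff)))
      have hB := conj j g _ hg (comB i (j + 1) (by omega) _ _ hf hg.diff)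
      refine mulA _ _ ?_ hB
      have := conj j g _ hg (conj i f _ hf (conj' j g _ hg (conj' i f _ hf hA)))
      convert this using 1
      simp only [commutatorElement_def]
      group
    constructor
    · intro f g hf hg
      refine step _ _ (mul_mem hf.zero_mem hg.zero_mem) (diffMul f g hf hg) ?_
      rw [mul_inv_rev]
      exact diffMul _ _ hg.inv hf.inv
    · intro i j hij f g hf hg
      refine step _ _ ?_ (diffCom i j hij f g hf hg) ?_
      · rw [← hij]
        exact hc i j (Subgroup.commutator_mem_commutator hf.zero_mem hg.zero_mem)
      · rw [commutatorElement_inv]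
        exact diffCom j i (by omega) g f hg hf

theorem mul {s : ℕ} (hΓ : Antitone Γ) (hs : ∀ i, s < i → Γ i = ⊥)
    (hc : ∀ i j, ⁅Γ i, Γ j⁆ ≤ Γ (i + j)) (hf : IsPolynomialSeq Γ i f) (hg : IsPolynomialSeq Γ i g) :
    IsPolynomialSeq Γ i (f * g) :=
  (mul_and_commutator hΓ hs hc (2 * s + 1) i (by omega)).1 f g hf hg

theorem commutator {s : ℕ} (hΓ : Antitone Γ) (hs : ∀ i, s < i → Γ i = ⊥)
    (hc : ∀ i j, ⁅Γ i, Γ j⁆ ≤ Γ (i + j)) (hf : IsPolynomialSeq Γ i f) (hg : IsPolynomialSeq Γ j g) :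
    IsPolynomialSeq Γ (i + j) ⁅f, g⁆ :=
  (mul_and_commutator hΓ hs hc (2 * s + 1) (i + j) (by omega)).2 i j rfl f g hf hg

theorem pow_choose (t : ℕ) {i : ℕ} {x : G} (hx : x ∈ Γ (t + i)) :
    IsPolynomialSeq Γ i (fun n => x ^ n.choose t) := by
  induction t generalizing i x with
  | zero => simpa using const (by simpa using hx)
  | succ t ih =>
    have key : ∀ y : G, seqDiff (fun n => y ^ n.choose (t + 1)) = fun n => y ^ n.choose t := by
      intro y
      ext n
      simp only [seqDiff, Nat.choose_succ_succ' n t]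
      rw [Nat.add_comm (n.choose t), pow_add, inv_mul_cancel_left]
    have hinv : (fun n : ℕ => x ^ n.choose (t + 1))⁻¹ = fun n => x⁻¹ ^ n.choose (t + 1) := by
      ext n; simp
    refine step _ _ (by simp [one_mem]) ?_ ?_
    · rw [key]; exact ih (by convert hx using 2; omega)
    · rw [hinv, key]; exact ih (inv_mem (by convert hx using 2; omega))

/-- The leading Taylor coefficient at `0` of a polynomial sequence lies in the expected term of the
filtration. -/
theorem apply_mem (h : IsPolynomialSeq Γ j f) {t : ℕ} (hf : ∀ k < t, f k = 1) :
    f t ∈ Γ (t + j) := by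
  induction t generalizing j f with
  | zero => simpa using h.zero_mem
  | succ t ih =>
    have := ih h.diff (fun k hk => by
      simp [seqDiff, hf k (by omega), hf (k + 1) (by omega)])
    rw [seqDiff, hf t (by omega), inv_one, one_mul] at this
    convert this using 2
    omega

/-- If the Taylor coefficients of `f` below `t` vanish and all the later ones, being elements `h` of
`Γ (i + j)`, satisfy `h ^ (N.choose i) = 1`, then `f N = 1`. The coefficients are stripped off one
at a time, by dividing by `n ↦ f(t) ^ (n.choose t)`. -/
theorem apply_eq_one {s : ℕ} (hΓ : Antitone Γ) (hs : ∀ i, s < i → Γ i = ⊥)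
    (hc : ∀ i j, ⁅Γ i, Γ j⁆ ≤ Γ (i + j)) {N : ℕ} (t : ℕ) (h : IsPolynomialSeq Γ j f)
    (hf : ∀ k < t, f k = 1) (hN : ∀ i, t ≤ i → ∀ x ∈ Γ (i + j), x ^ N.choose i = 1) :
    f N = 1 := by
  induction hd : s + 1 - t generalizing t f with
  | zero =>
    have : ∀ n, ∀ k < n, f k = 1 := by
      intro n
      induction n with
      | zero => intro k hk; omega
      | succ n ih =>
        intro k hk
        rcases Nat.lt_or_ge k n with hkn | hkn
        · exact ih k hkn
        · obtain rfl : k = n := by omega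
          rcases Nat.lt_or_ge k t with hkt | hkt
          · exact hf k hkt
          · have := h.apply_mem ih
            rwa [hs _ (by omega), Subgroup.mem_bot] at this
    exact this (N + 1) N (by omega)
  | succ d ih =>
    have ht := h.apply_mem hf
    have h1 := ih (t + 1) ((pow_choose t ht).inv.mul hΓ hs hc h) (fun k hk => by
      rcases Nat.lt_succ_iff_lt_or_eq.mp hk with hkt | rfl
      · simp [hf k hkt, Nat.choose_eq_zero_of_lt hkt]
      · simp) (fun i hi => hN i (by omega)) (by omega)
    simpa [hN t le_rfl _ ht] using h1

end IsPolynomialSeq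

end PolynomialSequences

/-! ### The lower central series as a filtration -/

section LowerCentralFiltration

variable {G : Type*} [Group G]

theorem Subgroup.commutator_commutator_le_of_rotate {H₁ H₂ H₃ N : Subgroup G} [N.Normal]
    (h1 : ⁅⁅H₂, H₃⁆, H₁⁆ ≤ N) (h2 : ⁅⁅H₃, H₁⁆, H₂⁆ ≤ N) : ⁅⁅H₁, H₂⁆, H₃⁆ ≤ N := by
  have key : ∀ A : Subgroup G, A ≤ N ↔ A.map (QuotientGroup.mk' N) = ⊥ := fun A => by
    rw [Subgroup.map_eq_bot_iff, QuotientGroup.ker_mk']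
  rw [key, Subgroup.map_commutator, Subgroup.map_commutator] at *
  exact Subgroup.commutator_commutator_eq_bot_of_rotate h1 h2

theorem Subgroup.commutator_lowerCentralSeries_le (i j : ℕ) :
    ⁅(⊤ : Subgroup G).lowerCentralSeries i, (⊤ : Subgroup G).lowerCentralSeries j⁆ ≤
      (⊤ : Subgroup G).lowerCentralSeries (i + j + 1) := by
  induction j generalizing i with
  | zero => exact le_rfl
  | succ j ih =>
    rw [Subgroup.commutator_comm, Subgroup.lowerCentralSeries_succ _ j]
    apply Subgroup.commutator_commutator_le_of_rotate
    · rw [Subgroup.commutator_comm ⊤]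
      have := ih (i + 1)
      rwa [show i + 1 + j + 1 = i + (j + 1) + 1 by omega] at this
    · exact Subgroup.commutator_mono (ih i) le_rfl

/-- The lower central series with the classical numbering, starting at `1`; the term at `0` is the
whole group as well. -/
def lcsFiltration (G : Type*) [Group G] (i : ℕ) : Subgroup G :=
  (⊤ : Subgroup G).lowerCentralSeries (i - 1)

theorem lcsFiltration_antitone : Antitone (lcsFiltration G) := fun _ _ h =>
  (⊤ : Subgroup G).lowerCentralSeries_antitone (Nat.sub_le_sub_right h 1)

theorem commutator_lcsFiltration_le (i j : ℕ) :
    ⁅lcsFiltration G i, lcsFiltration G j⁆ ≤ lcsFiltration G (i + j) :=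
  (Subgroup.commutator_lowerCentralSeries_le _ _).trans
    ((⊤ : Subgroup G).lowerCentralSeries_antitone (by omega))

theorem mem_lcsFiltration_of_le_one {i : ℕ} (hi : i ≤ 1) (x : G) : x ∈ lcsFiltration G i := by
  rw [lcsFiltration, Nat.sub_eq_zero_of_le hi]
  trivial

theorem lcsFiltration_eq_bot {c : ℕ} (hc : (⊤ : Subgroup G).lowerCentralSeries (c + 1) = ⊥) (i : ℕ)
    (hi : c + 1 < i) : lcsFiltration G i = ⊥ :=
  le_bot_iff.mp (hc ▸ (⊤ : Subgroup G).lowerCentralSeries_antitone (by omega))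

end LowerCentralFiltration

/-! ### Exponents of the lower central series of a two-generator group -/

section Exponents

theorem Nat.Prime.pow_dvd_choose_pow {p : ℕ} (hp : p.Prime) {E N i : ℕ} (hi : i ≠ 0)
    (h : E + i.factorization p ≤ N) : p ^ E ∣ (p ^ N).choose i := by
  rcases Nat.lt_or_ge (p ^ N) i with h0 | h0
  · simp [Nat.choose_eq_zero_of_lt h0]
  · rw [hp.pow_dvd_iff_le_factorization (Nat.choose_pos h0).ne']
    have := Nat.factorization_choose_prime_pow_add_factorization hp h0 hi
    omega

theorem Nat.Prime.factorization_mul_sub_one_lt {p : ℕ} (hp : p.Prime) {i : ℕ} (hi : i ≠ 0) :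
    i.factorization p * (p - 1) < i := by
  have h1 : p ^ i.factorization p ≤ i := Nat.ordProj_le p hi
  have h2 : 1 + i.factorization p * (p - 1) ≤ p ^ i.factorization p := by
    have := one_add_mul_le_pow (R := ℤ) (a := (p : ℤ) - 1) (by have := hp.two_le; omega)
      (i.factorization p)
    have hp1 : ((p - 1 : ℕ) : ℤ) = p - 1 := by have := hp.one_le; push_cast [this]; ring
    zify
    rw [hp1]
    simpa using this
  omega

/-- The exponents `⌊(c + 1 - j) / (p - 1)⌋` of the terms of the lower central series decrease fast
enough to absorb the denominators of the binomial coefficients. -/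
theorem Nat.Prime.div_add_factorization_le {p : ℕ} (hp : p.Prime) {a b i : ℕ} (hi : i ≠ 0)
    (h : a + i ≤ b + 1) : a / (p - 1) + i.factorization p ≤ b / (p - 1) := by
  have h1 := hp.factorization_mul_sub_one_lt hi
  have hp1 : 0 < p - 1 := by have := hp.two_le; omega
  rw [← Nat.add_mul_div_right _ _ hp1]
  exact Nat.div_le_div_right (by omega)

variable {G : Type*} [Group G]

/-- In a two-generator group in which `x ^ q` commutes with `y`, every element of the `j`-th term of
the lower central series, `j ≥ 2`, is the value at `1` of a polynomial sequence of level `j - 1`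
that vanishes at all multiples of `q`. -/
theorem exists_isPolynomialSeq_of_mem_lcsFiltration {c : ℕ} {x y : G} {q : ℕ}
    (hgen : Subgroup.closure {x, y} = ⊤) (hc : (⊤ : Subgroup G).lowerCentralSeries (c + 1) = ⊥)
    (hxy : Commute (x ^ q) y) (j : ℕ) (u : G) (hu : u ∈ lcsFiltration G (j + 2)) :
    ∃ f, IsPolynomialSeq (lcsFiltration G) (j + 1) f ∧ f 1 = u ∧ ∀ k, f (q * k) = 1 := by
  have hA := lcsFiltration_antitone (G := G)
  have hB := lcsFiltration_eq_bot hc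
  have hC := commutator_lcsFiltration_le (G := G)
  have hconst : ∀ h : G, IsPolynomialSeq (lcsFiltration G) 1 (fun _ => h) := fun h =>
    .const (mem_lcsFiltration_of_le_one le_rfl h)
  -- The values at `1` of such sequences form a subgroup.
  let U : ℕ → Subgroup G := fun j =>
    { carrier := {u | ∃ f, IsPolynomialSeq (lcsFiltration G) (j + 1) f ∧ f 1 = u ∧
        ∀ k, f (q * k) = 1}
      one_mem' := ⟨1, .one _, rfl, fun _ => rfl⟩
      mul_mem' := by
        rintro _ _ ⟨f, hf, rfl, hf'⟩ ⟨g, hg, rfl, hg'⟩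
        exact ⟨f * g, hf.mul hA hB hC hg, rfl, fun k => by simp [hf' k, hg' k]⟩
      inv_mem' := by
        rintro _ ⟨f, hf, rfl, hf'⟩
        exact ⟨f⁻¹, hf.inv, rfl, fun k => by simp [hf' k]⟩ }
  have hcom : ∀ j, ⁅U j, (⊤ : Subgroup G)⁆ ≤ U (j + 1) := fun j => by
    rw [Subgroup.commutator_le]
    rintro _ ⟨f, hf, rfl, hf'⟩ h -
    exact ⟨⁅f, fun _ => h⁆, hf.commutator hA hB hC (hconst h), rfl, fun k => by
      simp [commutatorElement_def, hf' k]⟩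
  have hanti : U 1 ≤ U 0 := by
    rintro _ ⟨f, hf, rfl, hf'⟩
    exact ⟨f, hf.mono hA (by omega), rfl, hf'⟩
  have hnorm : (U 0).Normal := Subgroup.commutator_top_right_le_iff.mp ((hcom 0).trans hanti)
  have hxyU : ⁅x, y⁆ ∈ U 0 := by
    refine ⟨⁅fun n => x ^ n.choose 1, fun _ => y⁆,
      (IsPolynomialSeq.pow_choose (i := 0) 1 (mem_lcsFiltration_of_le_one (by simp) x)).commutator
        hA hB hC (hconst y), by simp [commutatorElement_def], fun k => ?_⟩
    have : ⁅x ^ (q * k), y⁆ = 1 :=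
      commutatorElement_eq_one_iff_commute.mpr (by rw [pow_mul]; exact hxy.pow_left k)
    simpa [commutatorElement_def] using this
  -- Modulo `U 0` the two generators commute.
  have hbase : (⊤ : Subgroup G).lowerCentralSeries 1 ≤ U 0 := by
    have hle : (⊤ : Subgroup (G ⧸ U 0)) ≤ Subgroup.closure {(x : G ⧸ U 0), (y : G ⧸ U 0)} := by
      have := congrArg (Subgroup.map (QuotientGroup.mk' (U 0))) hgen
      rw [MonoidHom.map_closure, Subgroup.map_top_of_surjective _ (QuotientGroup.mk'_surjective _),
        Set.image_pair] at this
      exact this.ge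
    have hcomm : ∀ a ∈ ({(x : G ⧸ U 0), (y : G ⧸ U 0)} : Set _),
        ∀ b ∈ ({(x : G ⧸ U 0), (y : G ⧸ U 0)} : Set _), a * b = b * a := by
      have : (x : G ⧸ U 0) * y = y * x := by
        rw [← commutatorElement_eq_one_iff_mul_comm]
        exact (QuotientGroup.eq_one_iff _).mpr hxyU
      rintro a (rfl | rfl) b (rfl | rfl) <;> first | rfl | exact this | exact this.symm
    rw [Subgroup.top_lowerCentralSeries_one, commutator_def, Subgroup.commutator_le]
    intro a _ b _
    have ha := hle (Subgroup.mem_top (a : G ⧸ U 0))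
    have hb := hle (Subgroup.mem_top (b : G ⧸ U 0))
    have := (Subgroup.isMulCommutative_closure hcomm).is_comm.comm ⟨_, ha⟩ ⟨_, hb⟩
    rw [← QuotientGroup.eq_one_iff]
    exact commutatorElement_eq_one_iff_mul_comm.mpr (congrArg Subtype.val this)
  have hall : ∀ j, (⊤ : Subgroup G).lowerCentralSeries (j + 1) ≤ U j := by
    intro j
    induction j with
    | zero => exact hbase
    | succ j ih => exact (Subgroup.commutator_mono ih le_rfl).trans (hcom j)
  exact hall j hu

/-- The `j`-th term of the lower central series has exponent dividing
`p ^ (α + ⌊(c + 1 - j) / (p - 1)⌋)`, by downward induction on `j`. -/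
theorem pow_eq_one_of_mem_lcsFiltration {p : ℕ} (hp : p.Prime) {c α : ℕ} {x y : G}
    (hgen : Subgroup.closure {x, y} = ⊤) (hc : (⊤ : Subgroup G).lowerCentralSeries (c + 1) = ⊥)
    (hxy : Commute (x ^ p ^ α) y) (j : ℕ) (hj : 2 ≤ j) (u : G) (hu : u ∈ lcsFiltration G j) :
    u ^ p ^ (α + (c + 1 - j) / (p - 1)) = 1 := by
  induction hd : c + 2 - j using Nat.strong_induction_on generalizing j u with
  | _ d ih =>
  rcases Nat.lt_or_ge (c + 1) j with hcj | hcj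
  · rw [lcsFiltration_eq_bot hc j hcj, Subgroup.mem_bot] at hu
    rw [hu, one_pow]
  obtain ⟨j, rfl⟩ := Nat.exists_eq_add_of_le' hj
  obtain ⟨f, hf, rfl, hf'⟩ := exists_isPolynomialSeq_of_mem_lcsFiltration hgen hc hxy j u hu
  set N := p ^ (α + (c + 1 - (j + 2)) / (p - 1)) with hN
  have hA := lcsFiltration_antitone (G := G)
  have hB := lcsFiltration_eq_bot hc
  have hC := commutator_lcsFiltration_le (G := G)
  have h0 : f 0 = 1 := by simpa using hf' 0
  have hfN : f N = 1 := by
    rw [hN, pow_add]; exact hf' _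
  have hpow : IsPolynomialSeq (lcsFiltration G) (j + 1) (fun n => f 1 ^ n.choose 1) :=
    .pow_choose 1 (by rwa [show 1 + (j + 1) = j + 2 by omega])
  have := (hpow.inv.mul hA hB hC hf).apply_eq_one hA hB hC (N := N) 2
    (fun k hk => by interval_cases k <;> simp [h0]) (fun i hi h hh => by
      have hdvd : p ^ (α + (c + 1 - (i + (j + 1))) / (p - 1)) ∣ N.choose i ∨
          c + 1 < i + (j + 1) := by
        rcases Nat.lt_or_ge (c + 1) (i + (j + 1)) with h1 | h1
        · exact Or.inr h1
        · refine Or.inl (hp.pow_dvd_choose_pow (by omega) ?_)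
          rw [add_assoc]
          exact Nat.add_le_add_left (hp.div_add_factorization_le (by omega) (by omega)) α
      rcases hdvd with ⟨r, hr⟩ | hlt
      · rw [hr, pow_mul, ih _ (by omega) (i + (j + 1)) (by omega) h hh rfl, one_pow]
      · rw [hB _ hlt, Subgroup.mem_bot] at hh
        rw [hh, one_pow])
  simpa [hfN] using this

theorem commute_pow_of_closure_eq_top {p : ℕ} (hp : p.Prime) {c α : ℕ} (hc0 : 0 < c) {x y : G}
    (hgen : Subgroup.closure {x, y} = ⊤) (hc : (⊤ : Subgroup G).lowerCentralSeries (c + 1) = ⊥)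
    (hxy : Commute (x ^ p ^ α) y) : Commute x (y ^ p ^ (α + (c - 1) / (p - 1))) := by
  have hA := lcsFiltration_antitone (G := G)
  have hB := lcsFiltration_eq_bot hc
  have hC := commutator_lcsFiltration_le (G := G)
  set N := p ^ (α + (c - 1) / (p - 1)) with hN
  have hconst : IsPolynomialSeq (lcsFiltration G) 1 (fun _ => x) :=
    .const (mem_lcsFiltration_of_le_one le_rfl x)
  have hpow : IsPolynomialSeq (lcsFiltration G) 0 (fun n => y ^ n.choose 1) :=
    .pow_choose 1 (mem_lcsFiltration_of_le_one le_rfl y)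
  have := (hconst.commutator hA hB hC hpow).apply_eq_one hA hB hC (N := N) 1
    (fun k hk => by
      obtain rfl : k = 0 := by omega
      simp [commutatorElement_def])
    (fun i hi h hh => by
      rw [show i + (1 + 0) = i + 1 from rfl] at hh
      rcases Nat.lt_or_ge (c + 1) (i + 1) with h1 | h1
      · rw [hB _ h1, Subgroup.mem_bot] at hh
        rw [hh, one_pow]
      · obtain ⟨r, hr⟩ : p ^ (α + (c + 1 - (i + 1)) / (p - 1)) ∣ N.choose i := by
          refine hp.pow_dvd_choose_pow (by omega) ?_
          rw [add_assoc]
          exact Nat.add_le_add_left (hp.div_add_factorization_le (by omega) (by omega)) α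
        rw [hr, pow_mul, pow_eq_one_of_mem_lcsFiltration hp hgen hc hxy _ (by omega) h hh, one_pow])
  rw [← commutatorElement_eq_one_iff_commute]
  simpa [commutatorElement_def] using this

/-- The commutation bound for two elements of an arbitrary group of class at most `c + 1`. -/
theorem commute_pow_of_commute_pow {p : ℕ} (hp : p.Prime) {c α : ℕ} (hc0 : 0 < c)
    (hc : (⊤ : Subgroup G).lowerCentralSeries (c + 1) = ⊥) {x y : G}
    (hxy : Commute (x ^ p ^ α) y) : Commute x (y ^ p ^ (α + (c - 1) / (p - 1))) := by
  let H := Subgroup.closure {x, y}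
  have hx : x ∈ H := Subgroup.subset_closure (by simp)
  have hy : y ∈ H := Subgroup.subset_closure (by simp)
  have hgen : Subgroup.closure {(⟨x, hx⟩ : H), ⟨y, hy⟩} = ⊤ := by
    rw [← Subgroup.closure_closure_coe_preimage (k := {x, y})]
    congr 1
    ext ⟨z, hz⟩
    simp [Subtype.ext_iff]
  have hcH : (⊤ : Subgroup H).lowerCentralSeries (c + 1) = ⊥ := by
    rw [← Subgroup.map_eq_bot_iff_of_injective _ H.subtype_injective,
      Subgroup.top_subtype_lowerCentralSeries, ← le_bot_iff, ← hc]
    exact Subgroup.lowerCentralSeries_mono (c + 1) le_top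
  have := commute_pow_of_closure_eq_top hp hc0 hgen hcH (Subtype.ext hxy.eq)
  exact congrArg Subtype.val this.eq

end Exponents

/-! ### The order bound for capable groups -/

/-- If `G = K / Z(K)`, the `p ^ α`-th powers of lifts of the other generators to `K` are central, so
the `p ^ (α + m)`-th power of a lift of the last one commutes with all of them. -/
theorem capableOrderBound {p c : ℕ} (hp : p.Prime) (hc : 0 < c) :
    CapableOrderBound.{u} p c ((c - 1) / (p - 1)) := by
  rintro G _ hG ⟨K, _, ⟨e⟩⟩ ⟨hnil, hcl⟩ n x - hmin hmono a b ha hb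
  have : Fact p.Prime := ⟨hp⟩
  let π : K →* G := e.symm.toMonoidHom.comp (QuotientGroup.mk' (Subgroup.center K))
  have hπ : Function.Surjective π := e.symm.surjective.comp (QuotientGroup.mk'_surjective _)
  have hker : ∀ k, π k = 1 ↔ k ∈ Subgroup.center K := fun k => by
    simp [π]
  choose y hy using fun i => hπ (x i)
  have hlcs : (⊤ : Subgroup K).lowerCentralSeries (c + 1) = ⊥ := by
    apply Subgroup.lowerCentralSeries_succ_eq_bot
    intro k hk
    have h1 := Subgroup.mem_map_of_mem π hk
    rw [Subgroup.map_lowerCentralSeries, Subgroup.map_top_of_surjective π hπ, ← hcl,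
      Subgroup.lowerCentralSeries_nilpotencyClass, Subgroup.mem_bot, hker] at h1
    exact h1
  set N := p ^ (a + (c - 1) / (p - 1)) with hN
  have hcomm : ∀ i, Commute (y i) (y (Fin.last (n + 1)) ^ N) := by
    intro i
    rcases Fin.eq_castSucc_or_eq_last i with ⟨i, rfl⟩ | rfl
    · refine commute_pow_of_commute_pow hp hc hlcs ?_
      -- The order of `x i` is a power of `p` that is at most `p ^ a`.
      have hle : orderOf (x i.castSucc) ≤ p ^ a :=
        ha ▸ hmono (Fin.castSucc_le_castSucc_iff.mpr (Fin.le_last i))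
      obtain ⟨k, hk⟩ := IsPGroup.iff_orderOf.mp hG (x i.castSucc)
      rw [hk] at hle
      have hdvd : orderOf (x i.castSucc) ∣ p ^ a :=
        hk ▸ pow_dvd_pow p ((Nat.pow_le_pow_iff_right hp.one_lt).mp hle)
      have hcen : y i.castSucc ^ p ^ a ∈ Subgroup.center K := by
        rw [← hker, map_pow, hy]
        exact orderOf_dvd_iff_pow_eq_one.mp hdvd
      exact (Subgroup.mem_center_iff.mp hcen _).symm
    · exact (Commute.refl _).pow_right N
  -- The centralizer contains the center and maps onto `G`, so it is everything.
  have hcent : Subgroup.centralizer {y (Fin.last (n + 1)) ^ N} = ⊤ := by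
    have hmap : (Subgroup.centralizer {y (Fin.last (n + 1)) ^ N}).map π = ⊤ := by
      rw [eq_top_iff, ← hmin.prop, Subgroup.closure_le]
      rintro _ ⟨i, rfl⟩
      exact ⟨y i, Subgroup.mem_centralizer_singleton_iff.mpr (hcomm i).eq, hy i⟩
    have := congrArg (Subgroup.comap π) hmap
    rwa [Subgroup.comap_map_eq_self, Subgroup.comap_top] at this
    exact fun k hk => Subgroup.center_le_centralizer _ ((hker k).mp hk)
  have hlast : x (Fin.last (n + 1)) ^ N = 1 := by
    rw [← hy, ← map_pow, hker, Subgroup.mem_center_iff]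
    intro k
    exact Subgroup.mem_centralizer_singleton_iff.mp (hcent ▸ Subgroup.mem_top k)
  have := orderOf_dvd_of_pow_eq_one hlast
  rw [hb, hN] at this
  exact (Nat.pow_dvd_pow_iff_le_right hp.one_lt).mp this

/-! ### Nilpotent groups generated by elements of prime power order -/

theorem CommGroup.finite_and_isPGroup_of_closure_eq_top {p : ℕ} (hp : p.Prime) {A : Type*}
    [CommGroup A] {S : Set A} (hS : S.Finite) (hgen : Subgroup.closure S = ⊤)
    (hord : ∀ s ∈ S, ∃ k : ℕ, s ^ p ^ k = 1) : Finite A ∧ IsPGroup p A := by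
  have hP : IsPGroup p A := by
    intro g
    have hg : g ∈ Subgroup.closure S := hgen ▸ Subgroup.mem_top g
    induction hg using Subgroup.closure_induction with
    | mem s hs => exact hord s hs
    | one => exact ⟨0, one_pow _⟩
    | mul a b _ _ iha ihb =>
      obtain ⟨k, hk⟩ := iha
      obtain ⟨l, hl⟩ := ihb
      refine ⟨k + l, ?_⟩
      rw [mul_pow, pow_add, pow_mul, hk, one_pow, mul_comm (p ^ k), pow_mul, hl, one_pow, one_mul]
    | inv a _ ih =>
      obtain ⟨k, hk⟩ := ih
      exact ⟨k, by rw [inv_pow, hk, inv_one]⟩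
  have : Group.FG A := Group.fg_iff.mpr ⟨S, hgen, hS⟩
  refine ⟨CommGroup.finite_of_fg_isMulTorsion A fun g => ?_, hP⟩
  obtain ⟨k, hk⟩ := hP g
  exact isOfFinOrder_iff_pow_eq_one.mpr ⟨_, pow_pos hp.pos k, hk⟩

/-- Induction along central quotients: if `G ⧸ Z(G)` is a finite `p`-group, then so is the
commutator subgroup, by Schur's theorem, and `G` is an extension of its abelianization by it. -/
theorem Group.IsNilpotent.finite_and_isPGroup_of_closure_eq_top {p : ℕ} (hp : p.Prime)
    {G : Type u} [Group G] [Group.IsNilpotent G] {S : Set G} (hS : S.Finite)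
    (hgen : Subgroup.closure S = ⊤) (hord : ∀ s ∈ S, ∃ k : ℕ, s ^ p ^ k = 1) :
    Finite G ∧ IsPGroup p G := by
  have : Fact p.Prime := ⟨hp⟩
  have hmap : ∀ {G H : Type u} [Group G] [Group H] (f : G →* H), Function.Surjective f →
      ∀ {S : Set G}, Subgroup.closure S = ⊤ → (∀ s ∈ S, ∃ k : ℕ, s ^ p ^ k = 1) →
      Subgroup.closure (f '' S) = ⊤ ∧ ∀ s ∈ f '' S, ∃ k : ℕ, s ^ p ^ k = 1 := by
    intro G H _ _ f hf S hgen hord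
    refine ⟨by rw [← MonoidHom.map_closure, hgen, Subgroup.map_top_of_surjective f hf], ?_⟩
    rintro _ ⟨s, hs, rfl⟩
    obtain ⟨k, hk⟩ := hord s hs
    exact ⟨k, by rw [← map_pow, hk, map_one]⟩
  revert S
  refine Group.nilpotent_center_quotient_ind (P := fun G _ _ => ∀ {S : Set G}, S.Finite →
    Subgroup.closure S = ⊤ → (∀ s ∈ S, ∃ k : ℕ, s ^ p ^ k = 1) → Finite G ∧ IsPGroup p G) G ?_ ?_
  · intro G _ _ S _ _ _
    exact ⟨inferInstance, fun g => ⟨0, Subsingleton.elim _ _⟩⟩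
  · intro G _ _ ih S hS hgen hord
    obtain ⟨hZ1, hZ2⟩ := hmap (QuotientGroup.mk' (Subgroup.center G))
      (QuotientGroup.mk'_surjective _) hgen hord
    obtain ⟨hfin, hP⟩ := ih (hS.image _) hZ1 hZ2
    obtain ⟨hA1, hA2⟩ := hmap (Abelianization.of (G := G)) (QuotientGroup.mk'_surjective _)
      hgen hord
    obtain ⟨hfinA, hPA⟩ := CommGroup.finite_and_isPGroup_of_closure_eq_top hp (hS.image _) hA1 hA2
    -- A commutator depends only on the classes of its entries modulo the center.
    have hset : Finite (commutatorSet G) := by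
      refine (Set.finite_range fun q : (G ⧸ Subgroup.center G) × (G ⧸ Subgroup.center G) =>
        ⁅q.1.out, q.2.out⁆).subset ?_
      rintro _ ⟨g, h, rfl⟩
      refine ⟨(g, h), ?_⟩
      obtain ⟨⟨z, hz⟩, hgz⟩ := QuotientGroup.mk_out_eq_mul (Subgroup.center G) g
      obtain ⟨⟨w, hw⟩, hhw⟩ := QuotientGroup.mk_out_eq_mul (Subgroup.center G) h
      have hz' := Subgroup.mem_center_iff.mp hz
      have hw' := Subgroup.mem_center_iff.mp hw
      simp only [hgz, hhw]
      rw [commutatorElement_mul_left_eq_conj_mul,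
        commutatorElement_eq_one_iff_mul_comm.mpr (hz' _).symm, mul_one, mul_inv_cancel, one_mul,
        commutatorElement_mul_right_eq_mul_conj, commutatorElement_eq_one_iff_mul_comm.mpr (hw' _),
        mul_one, mul_assoc, mul_inv_cancel, mul_one]
    have hPc : IsPGroup p (commutator G) := by
      obtain ⟨k, hk⟩ := IsPGroup.iff_card.mp hP
      have := Subgroup.card_commutator_dvd_index_center_pow G
      rw [Subgroup.index, hk, ← pow_mul] at this
      exact IsPGroup.of_card_dvd_pow this
    have : Finite (G ⧸ commutator G) := hfinA
    refine ⟨Finite.of_subgroup_quotient (commutator G), fun g => ?_⟩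
    obtain ⟨k, hk⟩ := hPA (Abelianization.of g)
    rw [← map_pow] at hk
    obtain ⟨l, hl⟩ := hPc ⟨g ^ p ^ k, (QuotientGroup.eq_one_iff _).mp hk⟩
    exact ⟨k + l, by rw [pow_add, pow_mul]; exact congrArg Subtype.val hl⟩

/-! ### Affine maps of the cyclotomic integers -/

section CyclotomicGroup

/-- The powers of `λ = 1 - ζ` in the ring of integers of the `p`-th cyclotomic field behave as if
`p` were `λ ^ (p - 1)`; this follows by comparing norms, those of `λ` and `p` being `±p` and
`p ^ (p - 1)`. -/
theorem exists_root_of_unity_not_dvd {p : ℕ} (hp : p.Prime) :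
    ∃ (R : Type) (_ : CommRing R) (ζ : R), ζ ^ p = 1 ∧ ∀ m k : ℕ, m * (p - 1) < k →
      ∀ l : ℕ, ¬ (1 - ζ) ^ (k + l) ∣ (p : R) ^ m * (1 - ζ) ^ l := by
  have : Fact p.Prime := ⟨hp⟩
  have : NeZero p := ⟨hp.ne_zero⟩
  have : IsCyclotomicExtension {p} ℚ (CyclotomicField p ℚ) :=
    CyclotomicField.isCyclotomicExtension p ℚ
  have : NumberField (CyclotomicField p ℚ) := IsCyclotomicExtension.numberField {p} ℚ _
  have hζ := IsCyclotomicExtension.zeta_spec p ℚ (CyclotomicField p ℚ)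
  refine ⟨NumberField.RingOfIntegers (CyclotomicField p ℚ), inferInstance, hζ.toInteger,
    hζ.toInteger_isPrimitiveRoot.pow_eq_one, ?_⟩
  have hnorm : (Algebra.norm ℤ (1 - hζ.toInteger)).natAbs = p := by
    rw [← neg_sub, neg_eq_neg_one_mul, map_mul, Int.natAbs_mul,
      Int.isUnit_iff_natAbs_eq.mp (isUnit_one.neg.map (Algebra.norm ℤ)), one_mul]
    by_cases h2 : p = 2
    · subst h2
      rw [hζ.norm_toInteger_sub_one_of_eq_two]; rfl
    · rw [hζ.norm_toInteger_sub_one_of_prime_ne_two' h2]; rfl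
  have hnormp : Algebra.norm ℤ (p : NumberField.RingOfIntegers (CyclotomicField p ℚ)) =
      (p : ℤ) ^ (p - 1) := by
    have := Algebra.norm_algebraMap (S := NumberField.RingOfIntegers (CyclotomicField p ℚ)) (p : ℤ)
    rwa [NumberField.RingOfIntegers.rank, IsCyclotomicExtension.Rat.finrank p, Nat.totient_prime hp,
      map_natCast] at this
  intro m k hmk l hdvd
  have h := map_dvd (Algebra.norm ℤ) hdvd
  rw [map_mul, map_pow, map_pow, map_pow, hnormp, ← Int.natAbs_dvd_natAbs, Int.natAbs_mul,
    Int.natAbs_pow, Int.natAbs_pow, Int.natAbs_pow, Int.natAbs_pow, hnorm, Int.natAbs_natCast,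
    ← pow_mul, ← pow_add, Nat.pow_dvd_pow_iff_le_right hp.one_lt] at h
  rw [mul_comm] at hmk
  omega

variable {R : Type} [CommRing R]

/-- The group of units congruent to `1` modulo `r`. -/
def unitsCongrOne (r : R) : Subgroup Rˣ :=
  (Units.map (Ideal.Quotient.mk (Ideal.span {r})).toMonoidHom).ker

theorem mem_unitsCongrOne {r : R} {v : Rˣ} : v ∈ unitsCongrOne r ↔ r ∣ (v : R) - 1 := by
  rw [unitsCongrOne, MonoidHom.mem_ker, ← Ideal.mem_span_singleton, ← Ideal.Quotient.eq,
    Units.ext_iff]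
  rfl

/-- Multiplication by units, as an action on the additive group of the ring. -/
def unitsAction (U : Subgroup Rˣ) : U →* MulAut (Multiplicative R) :=
  ((MulAutMultiplicative R).symm.toMonoidHom.comp (DistribMulAction.toAddAut Rˣ R)).comp U.subtype

theorem unitsAction_apply {U : Subgroup Rˣ} (v : U) (x : Multiplicative R) :
    unitsAction U v x = Multiplicative.ofAdd (((v : Rˣ) : R) * x.toAdd) := rfl

/-- The group of affine maps `x ↦ v x + b` of a ring, with `v` a unit congruent to `1` modulo
`r`. -/
abbrev AffineCongr (r : R) : Type :=
  Multiplicative R ⋊[unitsAction (unitsCongrOne r)] (unitsCongrOne r)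

/-- The `n`-th term of the lower central series, `n ≥ 1`, lies in the group of translations by
multiples of `r ^ n`. This is so for `n = 1` because the units commute and are `1` modulo `r`. -/
theorem AffineCongr.dvd_of_mem_lowerCentralSeries (r : R) (n : ℕ) (g : AffineCongr r)
    (hg : g ∈ (⊤ : Subgroup (AffineCongr r)).lowerCentralSeries (n + 1)) :
    g.right = 1 ∧ r ^ (n + 1) ∣ g.left.toAdd := by
  -- The translations by multiples of `r ^ n`.
  let H : ℕ → Subgroup (AffineCongr r) := fun n =>
    { carrier := {g | g.right = 1 ∧ r ^ n ∣ g.left.toAdd}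
      one_mem' := ⟨rfl, dvd_zero _⟩
      mul_mem' := by
        rintro a b ⟨ha, ha'⟩ ⟨hb, hb'⟩
        refine ⟨by simp [ha, hb], ?_⟩
        simpa [ha] using dvd_add ha' hb'
      inv_mem' := by
        rintro a ⟨ha, ha'⟩
        refine ⟨by simp [ha], ?_⟩
        simpa [ha] using ha' }
  suffices h : (⊤ : Subgroup (AffineCongr r)).lowerCentralSeries (n + 1) ≤ H (n + 1) from h hg
  have hU : ∀ v : unitsCongrOne r, ∃ w : R, ((v : Rˣ) : R) = 1 + r * w := fun v => by
    obtain ⟨w, hw⟩ := mem_unitsCongrOne.mp v.2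
    exact ⟨w, by rw [← hw]; ring⟩
  have hcomm : ∀ a b : AffineCongr r, ⁅a, b⁆.right = 1 ∧ ⁅a, b⁆.left.toAdd =
      (1 - ((b.right : Rˣ) : R)) * a.left.toAdd - (1 - ((a.right : Rˣ) : R)) * b.left.toAdd := by
    intro a b
    have hr : ⁅a, b⁆.right = 1 := by
      simp [commutatorElement_def]
    refine ⟨hr, ?_⟩
    have : ⁅a, b⁆ * (b * a) = a * b := by simp [commutatorElement_def]
    have h := congrArg (fun g : AffineCongr r => g.left.toAdd) this
    simp only [SemidirectProduct.mul_left, hr, map_one, MulAut.one_apply, unitsAction_apply,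
      toAdd_mul, toAdd_ofAdd] at h
    linear_combination h
  clear hg
  induction n with
  | zero =>
    rw [Subgroup.lowerCentralSeries_succ, Subgroup.commutator_le]
    intro a _ b _
    obtain ⟨h1, h2⟩ := hcomm a b
    refine ⟨h1, ?_⟩
    obtain ⟨v, hv⟩ := hU a.right
    obtain ⟨w, hw⟩ := hU b.right
    rw [h2, hv, hw]
    exact ⟨-w * a.left.toAdd + v * b.left.toAdd, by ring⟩
  | succ n ih =>
    rw [Subgroup.lowerCentralSeries_succ, Subgroup.commutator_le]
    intro a ha b _
    obtain ⟨ha1, k, hk⟩ := ih ha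
    obtain ⟨h1, h2⟩ := hcomm a b
    refine ⟨h1, ?_⟩
    obtain ⟨w, hw⟩ := hU b.right
    rw [h2, ha1, hw, hk]
    exact ⟨-w * k, by push_cast; ring⟩

theorem AffineCongr.commutator_inl_inr {r : R} (x : R) (v : unitsCongrOne r) :
    ⁅(SemidirectProduct.inl (Multiplicative.ofAdd x) : AffineCongr r),
      (SemidirectProduct.inr v : AffineCongr r)⁆ =
      SemidirectProduct.inl (Multiplicative.ofAdd ((1 - ((v : Rˣ) : R)) * x)) := by
  have h : ⁅(SemidirectProduct.inl (Multiplicative.ofAdd x) : AffineCongr r),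
      (SemidirectProduct.inr v : AffineCongr r)⁆ = SemidirectProduct.inl (Multiplicative.ofAdd x *
        unitsAction (unitsCongrOne r) v (Multiplicative.ofAdd x)⁻¹) := by
    rw [map_mul, SemidirectProduct.inl_aut, commutatorElement_def, map_inv, map_inv]
    simp only [mul_assoc]
  rw [h, unitsAction_apply, ← ofAdd_neg, ← ofAdd_add, toAdd_ofAdd]
  congr 2
  ring

/-- The witness that the bound is sharp: the translation `z : x ↦ x + 1` and the multiplication
`a : x ↦ ζ x` in the group of affine maps of the cyclotomic integers. The commutators that occur are
translations by `p ^ m (1 - ζ)` and `(1 - ζ) ^ c`. -/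
theorem exists_commutators_notMem_lowerCentralSeries {p : ℕ} (hp : p.Prime) :
    ∃ (K : Type) (_ : Group K) (a z : K), a ^ p = 1 ∧ ∀ c : ℕ, 0 < c →
      ⁅z ^ p ^ ((c - 1) / (p - 1)), a⁆ ∉ (⊤ : Subgroup K).lowerCentralSeries (c + 1) ∧
      (fun w => ⁅w, a⁆)^[c] z ∉ (⊤ : Subgroup K).lowerCentralSeries (c + 1) := by
  obtain ⟨R, _, ζ, hζ, hdvd⟩ := exists_root_of_unity_not_dvd hp
  let v : Rˣ := Units.ofPowEqOne ζ p hζ hp.ne_zero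
  have hv : v ∈ unitsCongrOne (1 - ζ) := mem_unitsCongrOne.mpr ⟨-1, by simp [v]⟩
  refine ⟨AffineCongr (1 - ζ), inferInstance, SemidirectProduct.inr ⟨v, hv⟩,
    SemidirectProduct.inl (Multiplicative.ofAdd 1), ?_, fun c hc => ⟨fun h => ?_, fun h => ?_⟩⟩
  · rw [← map_pow, ← map_one SemidirectProduct.inr]
    congr 1
    exact Subtype.ext (Units.pow_ofPowEqOne hζ hp.ne_zero)
  · rw [← map_pow, ← ofAdd_nsmul, AffineCongr.commutator_inl_inr] at h
    have h1 := (AffineCongr.dvd_of_mem_lowerCentralSeries _ _ _ h).2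
    refine hdvd ((c - 1) / (p - 1)) c ?_ 1 ?_
    · have := Nat.div_mul_le_self (c - 1) (p - 1)
      omega
    · simpa [v, mul_comm] using h1
  · have hiter : ∀ n : ℕ, (fun w : AffineCongr (1 - ζ) => ⁅w, SemidirectProduct.inr ⟨v, hv⟩⁆)^[n]
        (SemidirectProduct.inl (Multiplicative.ofAdd 1)) =
        SemidirectProduct.inl (Multiplicative.ofAdd ((1 - ζ) ^ n)) := by
      intro n
      induction n with
      | zero => simp
      | succ n ih =>
        rw [Function.iterate_succ_apply', ih, AffineCongr.commutator_inl_inr, pow_succ']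
        rfl
    rw [hiter] at h
    have h1 := (AffineCongr.dvd_of_mem_lowerCentralSeries _ _ _ h).2
    refine hdvd 0 1 (by simp) c ?_
    simpa [add_comm] using h1

end CyclotomicGroup

/-! ### The central quotient of a two-generator group -/

section CentralQuotientOfTwoGenerator

variable {N : Type*} [Group N] {a z : N} {p c : ℕ}

theorem closure_singleton_ne_top_of_not_commute (haz : ¬ Commute z a)
    (g : N ⧸ Subgroup.center N) : Subgroup.closure {g} ≠ ⊤ := by
  intro hg
  have : IsCyclic (N ⧸ Subgroup.center N) :=
    isCyclic_iff_exists_zpowers_eq_top.mpr ⟨g, by rw [Subgroup.zpowers_eq_closure, hg]⟩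
  have := MonoidHom.isMulCommutative_of_isCyclic_of_ker_le_center
    (QuotientGroup.mk' (Subgroup.center N)) (QuotientGroup.ker_mk' _).le
  exact haz (this.is_comm.comm z a)

theorem closure_mk_pair_eq_top (hgen : Subgroup.closure {a, z} = ⊤) (H : Subgroup N) [H.Normal] :
    Subgroup.closure {(a : N ⧸ H), (z : N ⧸ H)} = ⊤ := by
  have := congrArg (Subgroup.map (QuotientGroup.mk' H)) hgen
  rwa [MonoidHom.map_closure, Subgroup.map_top_of_surjective _ (QuotientGroup.mk'_surjective _),
    Set.image_pair] at this

theorem isMinimalGeneratingSet_mk_pair (hgen : Subgroup.closure {a, z} = ⊤)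
    (haz : ¬ Commute z a) : IsMinimalGeneratingSet
      ({(a : N ⧸ Subgroup.center N), (z : N ⧸ Subgroup.center N)} : Set _) := by
  refine ⟨closure_mk_pair_eq_top hgen _, fun T hT hTS => ?_⟩
  have hsub : ∀ g, ¬ T ⊆ {g} := fun g hTg =>
    closure_singleton_ne_top_of_not_commute haz g
      (top_le_iff.mp (hT ▸ Subgroup.closure_mono hTg))
  rintro w (rfl | rfl)
  · by_contra hw
    refine hsub z fun t ht => ?_
    rcases hTS ht with rfl | h
    exacts [absurd ht hw, h]
  · by_contra hw
    refine hsub a fun t ht => ?_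
    rcases hTS ht with h | rfl
    exacts [h, absurd ht hw]

theorem mk_ne_mk_of_closure_eq_top (hgen : Subgroup.closure {a, z} = ⊤) (haz : ¬ Commute z a) :
    (a : N ⧸ Subgroup.center N) ≠ z := by
  intro h
  have := closure_mk_pair_eq_top hgen (Subgroup.center N)
  rw [h, Set.pair_eq_singleton] at this
  exact closure_singleton_ne_top_of_not_commute haz _ this

theorem orderOf_mk_left (hp : p.Prime) (ha : a ^ p = 1) (haz : ¬ Commute z a) :
    orderOf (a : N ⧸ Subgroup.center N) = p := by
  have : Fact p.Prime := ⟨hp⟩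
  refine orderOf_eq_prime (by rw [← QuotientGroup.mk_pow, ha]; rfl) fun h => haz ?_
  exact Subgroup.mem_center_iff.mp ((QuotientGroup.eq_one_iff a).mp h) z

theorem orderOf_mk_right (hp : p.Prime) (hc : 0 < c) (hgen : Subgroup.closure {a, z} = ⊤)
    (ha : a ^ p = 1) (hlcs : (⊤ : Subgroup N).lowerCentralSeries (c + 1) = ⊥)
    (haz : ¬ Commute (z ^ p ^ ((c - 1) / (p - 1))) a) :
    orderOf (z : N ⧸ Subgroup.center N) = p ^ (1 + (c - 1) / (p - 1)) := by
  have : Fact p.Prime := ⟨hp⟩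
  rw [add_comm]
  refine orderOf_eq_prime_pow (fun h => haz ?_) ?_
  · rw [← QuotientGroup.mk_pow, QuotientGroup.eq_one_iff, Subgroup.mem_center_iff] at h
    exact (h a).symm
  · rw [← QuotientGroup.mk_pow, QuotientGroup.eq_one_iff, add_comm]
    have h1 : Commute a (z ^ p ^ (1 + (c - 1) / (p - 1))) :=
      commute_pow_of_commute_pow hp hc hlcs (by rw [pow_one, ha]; exact Commute.one_left z)
    have h2 : Subgroup.closure {a, z} ≤
        Subgroup.centralizer {z ^ p ^ (1 + (c - 1) / (p - 1))} := by
      rw [Subgroup.closure_le]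
      rintro w (rfl | rfl)
      · exact Subgroup.mem_centralizer_singleton_iff.mpr h1.eq
      · exact Subgroup.mem_centralizer_singleton_iff.mpr ((Commute.refl _).pow_right _).eq
    rw [Subgroup.mem_center_iff]
    intro g
    exact Subgroup.mem_centralizer_singleton_iff.mp (h2 (hgen ▸ Subgroup.mem_top g))

theorem hasNilpotencyClass_quotient_center
    (hlcs : (⊤ : Subgroup N).lowerCentralSeries (c + 1) = ⊥)
    (hlcs' : (⊤ : Subgroup N).lowerCentralSeries c ≠ ⊥) :
    HasNilpotencyClass (N ⧸ Subgroup.center N) c := by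
  have hN : Group.IsNilpotent N := Subgroup.nilpotent_iff_lowerCentralSeries.mpr ⟨c + 1, hlcs⟩
  refine ⟨inferInstance, ?_⟩
  rw [Group.nilpotencyClass_quotient_center]
  have h1 := Subgroup.lowerCentralSeries_eq_bot_iff_nilpotencyClass_le.mp hlcs
  have h2 := mt Subgroup.lowerCentralSeries_eq_bot_iff_nilpotencyClass_le.mpr hlcs'
  omega

theorem finite_and_isPGroup_quotient_center (hp : p.Prime) (hc : 0 < c)
    (hgen : Subgroup.closure {a, z} = ⊤)
    (ha : a ^ p = 1) (hlcs : (⊤ : Subgroup N).lowerCentralSeries (c + 1) = ⊥)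
    (haz : ¬ Commute (z ^ p ^ ((c - 1) / (p - 1))) a) :
    Finite (N ⧸ Subgroup.center N) ∧ IsPGroup p (N ⧸ Subgroup.center N) := by
  have hN : Group.IsNilpotent N := Subgroup.nilpotent_iff_lowerCentralSeries.mpr ⟨c + 1, hlcs⟩
  refine Group.IsNilpotent.finite_and_isPGroup_of_closure_eq_top hp (Set.toFinite _)
    (closure_mk_pair_eq_top hgen (Subgroup.center N)) ?_
  rintro w (rfl | rfl)
  · exact ⟨1, by rw [pow_one, ← QuotientGroup.mk_pow, ha]; rfl⟩
  · exact ⟨_, orderOf_dvd_iff_pow_eq_one.mp (orderOf_mk_right hp hc hgen ha hlcs haz).dvd⟩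

end CentralQuotientOfTwoGenerator

/-- A two-generator group with the properties of the nilpotent product forces the constant in the
order bound to be at least `⌊(c - 1) / (p - 1)⌋`. -/
theorem le_of_capableOrderBound {N : Type u} [Group N] {a z : N} {p c m : ℕ} (hp : p.Prime)
    (hc : 0 < c) (hgen : Subgroup.closure {a, z} = ⊤) (ha : a ^ p = 1)
    (hlcs : (⊤ : Subgroup N).lowerCentralSeries (c + 1) = ⊥)
    (hlcs' : (⊤ : Subgroup N).lowerCentralSeries c ≠ ⊥)
    (haz : ¬ Commute (z ^ p ^ ((c - 1) / (p - 1))) a) (hm : CapableOrderBound.{u} p c m) :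
    (c - 1) / (p - 1) ≤ m := by
  have haz' : ¬ Commute z a := fun h => haz (h.pow_left _)
  have hoa := orderOf_mk_left hp ha haz'
  have hoz := orderOf_mk_right hp hc hgen ha hlcs haz
  have hle : orderOf (a : N ⧸ Subgroup.center N) ≤ orderOf (z : N ⧸ Subgroup.center N) := by
    rw [hoa, hoz]
    exact Nat.le_of_dvd (pow_pos hp.pos _)
      (dvd_pow_self p (n := 1 + (c - 1) / (p - 1)) (by positivity))
  have := hm (N ⧸ Subgroup.center N)
    (finite_and_isPGroup_quotient_center hp hc hgen ha hlcs haz).2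
    ⟨N, inferInstance, ⟨MulEquiv.refl _⟩⟩ (hasNilpotencyClass_quotient_center hlcs hlcs') 0
    ![(a : N ⧸ Subgroup.center N), (z : N ⧸ Subgroup.center N)] ?_ ?_ ?_ 1
    (1 + (c - 1) / (p - 1)) (by simpa using hoa) (by simpa using hoz)
  · omega
  · have hne := mk_ne_mk_of_closure_eq_top hgen haz'
    intro i j hij
    fin_cases i <;> fin_cases j <;> first | rfl | exact absurd hij hne | exact absurd hij hne.symm
  · rw [Matrix.range_cons_cons_empty]
    exact isMinimalGeneratingSet_mk_pair hgen haz'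
  · intro i j hij
    fin_cases i <;> fin_cases j <;> first | exact le_rfl | exact hle | exact absurd hij (by decide)

/-! ### The nilpotent product -/

section NilpotentProduct

variable {p : ℕ}

theorem closure_coprod_generators_eq_top (p : ℕ) :
    Subgroup.closure {(Monoid.Coprod.inl (Multiplicative.ofAdd (1 : ZMod p)) :
      Monoid.Coprod (Multiplicative (ZMod p)) (Multiplicative ℤ)),
      Monoid.Coprod.inr (Multiplicative.ofAdd (1 : ℤ))} = ⊤ := by
  rw [eq_top_iff]
  rintro g -
  induction g using Monoid.Coprod.induction_on with
  | inl x =>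
    obtain ⟨k, hk⟩ := ZMod.intCast_surjective x.toAdd
    have : x = Multiplicative.ofAdd (1 : ZMod p) ^ k := by
      rw [← ofAdd_zsmul, zsmul_one, hk, ofAdd_toAdd]
    rw [this, map_zpow]
    exact zpow_mem (Subgroup.subset_closure (by simp)) k
  | inr x =>
    have : x = Multiplicative.ofAdd (1 : ℤ) ^ x.toAdd := by
      rw [← ofAdd_zsmul, zsmul_one, Int.cast_id, ofAdd_toAdd]
    rw [this, map_zpow]
    exact zpow_mem (Subgroup.subset_closure (by simp)) _
  | mul x y hx hy => exact mul_mem hx hy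

theorem exists_coprod_hom {K : Type*} [Group K] {a z : K} (ha : a ^ p = 1) :
    ∃ f : Monoid.Coprod (Multiplicative (ZMod p)) (Multiplicative ℤ) →* K,
      f (Monoid.Coprod.inl (Multiplicative.ofAdd 1)) = a ∧
      f (Monoid.Coprod.inr (Multiplicative.ofAdd 1)) = z := by
  let g : ZMod p →+ Additive K := ZMod.lift p ⟨zmultiplesHom _ (Additive.ofMul a), by
    simpa [← ofMul_pow] using ha⟩
  have hg : g 1 = Additive.ofMul a := by
    have := ZMod.lift_coe p (f := ⟨zmultiplesHom _ (Additive.ofMul a), by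
      simpa [← ofMul_pow] using ha⟩) 1
    simpa using this
  refine ⟨Monoid.Coprod.lift (AddMonoidHom.toMultiplicativeLeft g) (zpowersHom K z), ?_, ?_⟩
  · rw [Monoid.Coprod.lift_apply_inl]
    exact congrArg Additive.toMul hg
  · simp

theorem map_lowerCentralSeries_mem {G H : Type*} [Group G] [Group H] (f : G →* H) {n : ℕ} {g : G}
    (hg : g ∈ (⊤ : Subgroup G).lowerCentralSeries n) :
    f g ∈ (⊤ : Subgroup H).lowerCentralSeries n := by
  have := Subgroup.mem_map_of_mem f hg
  rw [Subgroup.map_lowerCentralSeries] at this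
  exact Subgroup.lowerCentralSeries_mono n le_top this

theorem iterate_commutator_mem_lowerCentralSeries {G : Type*} [Group G] (a z : G) (n : ℕ) :
    (fun w => ⁅w, a⁆)^[n] z ∈ (⊤ : Subgroup G).lowerCentralSeries n := by
  induction n with
  | zero => trivial
  | succ n ih =>
    rw [Function.iterate_succ_apply']
    exact Subgroup.commutator_mem_commutator ih (Subgroup.mem_top a)

/-- The two negative statements, class at least `c + 1` and `z ^ (p ^ m)` not commuting with `a`,
are detected by the homomorphism from the free product to the affine maps of the cyclotomic
integers. -/
theorem cyclicNilpotentProduct_properties (hp : p.Prime) {c : ℕ} (hc : 0 < c) :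
    ∃ a z : CyclicNilpotentProduct (c + 1) p, genA (c + 1) p = QuotientGroup.mk a ∧
      genZ (c + 1) p = QuotientGroup.mk z ∧ Subgroup.closure {a, z} = ⊤ ∧ a ^ p = 1 ∧
      (⊤ : Subgroup (CyclicNilpotentProduct (c + 1) p)).lowerCentralSeries (c + 1) = ⊥ ∧
      (⊤ : Subgroup (CyclicNilpotentProduct (c + 1) p)).lowerCentralSeries c ≠ ⊥ ∧
      ¬ Commute (z ^ p ^ ((c - 1) / (p - 1))) a := by
  set F := Monoid.Coprod (Multiplicative (ZMod p)) (Multiplicative ℤ)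
  let L := (⊤ : Subgroup F).lowerCentralSeries (c + 1)
  set a : F := Monoid.Coprod.inl (Multiplicative.ofAdd (1 : ZMod p)) with ha
  set z : F := Monoid.Coprod.inr (Multiplicative.ofAdd (1 : ℤ)) with hz
  obtain ⟨K, _, a', z', ha', hK⟩ := exists_commutators_notMem_lowerCentralSeries hp
  obtain ⟨f, hfa, hfz⟩ := exists_coprod_hom (z := z') ha'
  obtain ⟨hK1, hK2⟩ := hK c hc
  refine ⟨(a : F ⧸ L), (z : F ⧸ L), rfl, rfl,
    closure_mk_pair_eq_top (closure_coprod_generators_eq_top p) L, ?_, ?_, fun h => ?_, fun h => ?_⟩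
  · rw [← QuotientGroup.mk_pow, ha, ← map_pow, ← ofAdd_nsmul, nsmul_one, CharP.cast_eq_zero,
      ofAdd_zero, map_one]
    rfl
  · rw [← Subgroup.map_top_of_surjective _ (QuotientGroup.mk'_surjective L),
      ← Subgroup.map_lowerCentralSeries, Subgroup.map_eq_bot_iff, QuotientGroup.ker_mk']
  · have h1 := map_lowerCentralSeries_mem (QuotientGroup.mk' L)
      (iterate_commutator_mem_lowerCentralSeries a z c)
    rw [h, Subgroup.mem_bot, QuotientGroup.mk'_apply, QuotientGroup.eq_one_iff] at h1
    have h2 := map_lowerCentralSeries_mem f h1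
    have hsemi : Function.Semiconj f (fun w => ⁅w, a⁆) (fun w => ⁅w, a'⁆) := fun w => by
      rw [map_commutatorElement, hfa]
    rw [(hsemi.iterate_right c).eq, hfz] at h2
    exact hK2 h2
  · rw [← commutatorElement_eq_one_iff_commute] at h
    have h1 : ⁅z ^ p ^ ((c - 1) / (p - 1)), a⁆ ∈ L := (QuotientGroup.eq_one_iff _).mp h
    have h2 := map_lowerCentralSeries_mem f h1
    rw [map_commutatorElement, map_pow, hfa, hfz] at h2
    exact hK1 h2

end NilpotentProduct

theorem mainTheorem1 (p c : ℕ) (hp : p.Prime) (hc : 0 < c) :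
    (Finite (CentralQuotient (c + 1) p) ∧
      IsPGroup p (CentralQuotient (c + 1) p) ∧
      Capable (CentralQuotient (c + 1) p) ∧
      HasNilpotencyClass (CentralQuotient (c + 1) p) c ∧
      genA (c + 1) p ≠ genZ (c + 1) p ∧
      IsMinimalGeneratingSet ({genA (c + 1) p, genZ (c + 1) p} : Set (CentralQuotient (c + 1) p)) ∧
      orderOf (genA (c + 1) p) = p ∧
      orderOf (genZ (c + 1) p) = p ^ (1 + (c - 1) / (p - 1))) ∧
    IsLeast {m : ℕ | CapableOrderBound.{u} p c m} ((c - 1) / (p - 1)) := by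
  obtain ⟨a, z, hA, hZ, hgen, ha, hlcs, hlcs', haz⟩ := cyclicNilpotentProduct_properties hp hc
  have haz' : ¬ Commute z a := fun h => haz (h.pow_left _)
  rw [hA, hZ]
  obtain ⟨hfin, hP⟩ := finite_and_isPGroup_quotient_center hp hc hgen ha hlcs haz
  refine ⟨⟨hfin, hP, ⟨_, inferInstance, ⟨MulEquiv.refl _⟩⟩,
    hasNilpotencyClass_quotient_center hlcs hlcs', mk_ne_mk_of_closure_eq_top hgen haz',
    isMinimalGeneratingSet_mk_pair hgen haz', orderOf_mk_left hp ha haz',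
    orderOf_mk_right hp hc hgen ha hlcs haz⟩, capableOrderBound hp hc, fun m hm => ?_⟩
  -- The nilpotent product is moved to the universe of the bound.
  let e : CyclicNilpotentProduct (c + 1) p ≃* ULift.{u} (CyclicNilpotentProduct (c + 1) p) :=
    MulEquiv.ulift.symm
  have hmap : ∀ n, (⊤ : Subgroup (ULift.{u} (CyclicNilpotentProduct (c + 1) p))).lowerCentralSeries
      n = ((⊤ : Subgroup (CyclicNilpotentProduct (c + 1) p)).lowerCentralSeries n).map
        e.toMonoidHom := fun n => by
    rw [Subgroup.map_lowerCentralSeries, Subgroup.map_top_of_surjective _ e.surjective]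
  refine le_of_capableOrderBound (a := e a) (z := e z) hp hc ?_ (by rw [← map_pow, ha, map_one])
    (by rw [hmap, hlcs, Subgroup.map_bot]) (fun h => hlcs' ?_) (fun h => haz ?_) hm
  · have := congrArg (Subgroup.map e.toMonoidHom) hgen
    rwa [MonoidHom.map_closure, Subgroup.map_top_of_surjective _ e.surjective,
      Set.image_pair] at this
  · rwa [hmap, Subgroup.map_eq_bot_iff_of_injective _ e.injective] at h
  · rw [← map_pow] at h
    exact (commute_map_iff e.injective).mp h
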